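/- A bigraphon $(J_1,J_2,W)$ consists of probability spaces $(J_1,\pi_1)$, $(J_2,\pi_2)$ and a measurable function $W:J_1\times J_2\to[0,1]$ (measurability with respect to the completion of $\pi_1\times\pi_2$ suffices). It is pure if all sections $W(x,\cdot)$ and $W(\cdot,y)$ are integrable, the neighborhood distances $$r_1(x,x')=\int_{J_2}|W(x,z)-W(x',z)|\,d\pi_2(z),\qquad r_2(y,y')=\int_{J_1}|W(z,y)-W(z,y')|\,d\pi_1(z)$$ make $J_1$ and $J_2$ complete separable metric spaces (in particular distinct points have positive distance), and every nonempty open subset of $(J_i,r_i)$ has positive $\pi_i$-measure ($i=1,2$). A bigraph is a triple $F=(U_1,U_2,E)$ with $U_1,U_2$ finite sets and $E\subseteq U_1\times U_2$; it has $|U_1|+|U_2|$ nodes. Its induced density in $W$ is $$t^{\mathsf b}_{\mathrm{ind}}(F,W)=\int_{J_1^{U_1}}\int_{J_2^{U_2}}\ \prod_{ij\in E}W(x_i,y_j)\prod_{ij\in (U_1\times U_2)\setminus E}\bigl(1-W(x_i,y_j)\bigr)\,dy\,dx .$$ The bigraphon is thin if $t^{\mathsf b}_{\mathrm{ind}}(F,W)=0$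 for some bigraph $F$. The (upper) packing dimension of a metric space is $\limsup_{\varepsilon\to0^+}\log N(\varepsilon)/\log(1/\varepsilon)$, where $N(\varepsilon)\in\mathbb N\cup\{\infty\}$ is the maximum number of points mutually at distance at least $\varepsilon$. **Theorem.** Let $(J_1,J_2,W)$ be a pure bigraphon that is thin. Then (a) $W(x,y)\in\{0,1\}$ for almost all $(x,y)\in J_1\times J_2$; (b) the metric spaces $(J_1,r_1)$ and $(J_2,r_2)$ are compact; (c) $(J_1,r_1)$ and $(J_2,r_2)$ have finite packing dimension; moreover, for every bigraph $F$ with $t^{\mathsf b}_{\mathrm{ind}}(F,W)=0$, both packing dimensions are at most $10k$, where $k$ is the number of nodes of $F$. -/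

import Mathlib

open MeasureTheory Filter Topology

/-- A bigraph `(U₁, U₂, E)`: finite sets `U₁`, `U₂` and an edge set `E ⊆ U₁ × U₂`. -/
structure Bigraph where
  U₁ : Type
  U₂ : Type
  [fintype₁ : Fintype U₁]
  [fintype₂ : Fintype U₂]
  E : Finset (U₁ × U₂)

attribute [instance] Bigraph.fintype₁ Bigraph.fintype₂

/-- The number of nodes of a bigraph. -/
def Bigraph.numNodes (F : Bigraph) : ℕ := Fintype.card F.U₁ + Fintype.card F.U₂

/-- `W` is a bigraphon on the probability spaces `(J₁, π₁)` and `(J₂, π₂)`: a `[0,1]`-valued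
function that is measurable with respect to the completion of the product measure (in particular
every jointly measurable function is allowed). -/
structure IsBigraphon {J₁ J₂ : Type*} [MeasurableSpace J₁] [MeasurableSpace J₂]
    (π₁ : Measure J₁) (π₂ : Measure J₂) (W : J₁ → J₂ → ℝ) : Prop where
  aemeasurable : AEMeasurable (Function.uncurry W) (π₁.prod π₂)
  mem_Icc : ∀ x y, W x y ∈ Set.Icc (0 : ℝ) 1

/-- The neighborhood distance `r₁(x, x') = ‖W(x,·) - W(x',·)‖₁` on `J₁`. -/
noncomputable def nbhdDist₁ {J₁ J₂ : Type*} [MeasurableSpace J₂] (π₂ : Measure J₂)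
    (W : J₁ → J₂ → ℝ) (x x' : J₁) : ℝ :=
  ∫ z, |W x z - W x' z| ∂π₂

/-- The neighborhood distance `r₂(y, y') = ‖W(·,y) - W(·,y')‖₁` on `J₂`. -/
noncomputable def nbhdDist₂ {J₁ J₂ : Type*} [MeasurableSpace J₁] (π₁ : Measure J₁)
    (W : J₁ → J₂ → ℝ) (y y' : J₂) : ℝ :=
  ∫ z, |W z y - W z y'| ∂π₁

/-- The bigraphon `W` is pure. The metric structures on `J₁` and `J₂` are those given by the
neighborhood distances `r₁` and `r₂` (which therefore separate points); these distances are defined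
for all pairs of points, that is, every section of `W` is an `L₁` function; both metric spaces are
complete and separable, and every nonempty open set has positive measure. -/
structure IsPureBigraphon {J₁ J₂ : Type*} [MeasurableSpace J₁] [MeasurableSpace J₂]
    [MetricSpace J₁] [MetricSpace J₂]
    (π₁ : Measure J₁) (π₂ : Measure J₂) (W : J₁ → J₂ → ℝ) : Prop
    extends IsBigraphon π₁ π₂ W where
  section₁ : ∀ x, AEMeasurable (fun y => W x y) π₂
  section₂ : ∀ y, AEMeasurable (fun x => W x y) π₁
  dist_eq₁ : ∀ x x' : J₁, dist x x' = nbhdDist₁ π₂ W x x'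
  dist_eq₂ : ∀ y y' : J₂, dist y y' = nbhdDist₂ π₁ W y y'
  complete₁ : CompleteSpace J₁
  complete₂ : CompleteSpace J₂
  separable₁ : TopologicalSpace.SeparableSpace J₁
  separable₂ : TopologicalSpace.SeparableSpace J₂
  full_support₁ : ∀ U : Set J₁, IsOpen U → U.Nonempty → 0 < π₁ U
  full_support₂ : ∀ U : Set J₂, IsOpen U → U.Nonempty → 0 < π₂ U

open Classical in
/-- The induced density of the bigraph `F` at a given choice `x, y` of the node variables:
`∏_{ij ∈ E} W(x_i, y_j) ∏_{ij ∉ E} (1 - W(x_i, y_j))`. -/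
noncomputable def inducedDensityAt {J₁ J₂ : Type*} (F : Bigraph) (W : J₁ → J₂ → ℝ)
    (x : F.U₁ → J₁) (y : F.U₂ → J₂) : ℝ :=
  (∏ p ∈ F.E, W (x p.1) (y p.2)) * ∏ p ∈ F.Eᶜ, (1 - W (x p.1) (y p.2))

/-- The induced density of the bigraph `F` in the bigraphon `W`. -/
noncomputable def inducedDensity {J₁ J₂ : Type*} [MeasurableSpace J₁] [MeasurableSpace J₂]
    (π₁ : Measure J₁) (π₂ : Measure J₂) (F : Bigraph) (W : J₁ → J₂ → ℝ) : ℝ :=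
  ∫ x : F.U₁ → J₁, ∫ y : F.U₂ → J₂, inducedDensityAt F W x y
    ∂(Measure.pi fun _ => π₂) ∂(Measure.pi fun _ => π₁)

/-- A bigraphon is thin if some bigraph has induced density `0` in it. -/
def IsThin {J₁ J₂ : Type*} [MeasurableSpace J₁] [MeasurableSpace J₂]
    (π₁ : Measure J₁) (π₂ : Measure J₂) (W : J₁ → J₂ → ℝ) : Prop :=
  ∃ F : Bigraph, inducedDensity π₁ π₂ F W = 0

/-- `N(ε)`: the supremum of the cardinalities of finite sets of points of `M` that are mutually at
distance at least `ε`. -/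
noncomputable def sepNumber (M : Type*) [MetricSpace M] (ε : ℝ) : ℕ∞ :=
  ⨆ (s : Finset M) (_ : (s : Set M).Pairwise fun x y => ε ≤ dist x y), (s.card : ℕ∞)

/-- The upper packing dimension `limsup_{ε → 0+} log N(ε) / log (1/ε)`, an extended real. -/
noncomputable def upperPackingDim (M : Type*) [MetricSpace M] : EReal :=
  limsup (fun ε : ℝ => ENNReal.log (sepNumber M ε : ENNReal) / (Real.log (1 / ε) : EReal)) (𝓝[>] 0)

/-! Vanishing density forces the nonnegative integrand to vanish almost everywhere. Where `0 < W <
1` that integrand is positive, so this set contains almost no grid of the size of `F`, and a set of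
positive measure would contain many (`measure_eq_zero_of_ae_grid_not_subset`); this gives (a).

For the packing bound, let `N` points of `J₁` be `ε`-separated and draw `M` random columns. Two rows
agree on all of them with probability at most about `(1 - ε/2) ^ M`, so `M` of order `log N / ε`
makes all rows distinct. After a small perturbation of the points, allowed by full support, the
sampled matrix is also `0/1`-valued and free of injective induced copies of `F`. By Sauer-Shelah it
then has at most `(M + 1) ^ k` rows, with `k` the number of nodes. Absorbing the logarithm yields `N
≤ C * (1 / ε) ^ (2 * k)`, hence total boundedness and finite dimension. The other side follows by
symmetry. -/

/-! ### Sauer-Shelah bound for matrices without induced copies of a bigraph. -/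

/-- A `0/1` matrix with pairwise distinct rows which contains no induced copy of `F`, where copies
are required to be injective on both classes, has polynomially many rows in terms of its columns. -/
theorem card_le_of_no_induced_copy (F : Bigraph) {ι : Type*} [Fintype ι] {M : ℕ}
    (A : ι → Fin M → ℝ) (h01 : ∀ i j, A i j = 0 ∨ A i j = 1) (hA : Function.Injective A)
    (hF : ∀ (f : F.U₁ → ι) (g : F.U₂ → Fin M), Function.Injective f → Function.Injective g →
      inducedDensityAt F A f g = 0) :
    Fintype.card ι ≤ (M + 1) ^ F.numNodes := by
  classical
  let row : ι → Finset (Fin M) := fun i => Finset.univ.filter fun j => A i j = 1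
  have mem_row : ∀ i j, j ∈ row i ↔ A i j = 1 := fun i j => by simp [row]
  have hrow : Function.Injective row := by
    intro i i' h
    apply hA
    funext j
    have hj : A i j = 1 ↔ A i' j = 1 := by rw [← mem_row, ← mem_row, h]
    rcases h01 i j with h1 | h1 <;> rcases h01 i' j with h2 | h2 <;> simp_all
  have hvc : (Finset.univ.image row).vcDim ≤ F.numNodes := by
    by_contra! hlt
    have : ∃ s, (Finset.univ.image row).Shatters s ∧ F.numNodes ≤ s.card := by
      by_contra! hs
      refine absurd hlt (not_lt.2 (Finset.sup_le fun s hs' => ?_))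
      exact (hs s (Finset.mem_shatterer.1 hs')).le
    obtain ⟨s, hs, hcard⟩ := this
    have hcard' : Fintype.card (F.U₁ ⊕ F.U₂) ≤ Fintype.card s := by
      simpa [Bigraph.numNodes] using hcard
    obtain ⟨e⟩ := Function.Embedding.nonempty_of_card_le hcard'
    -- The `inr` columns encode the edges of `F`; the `inl` columns serve as labels that force
    -- distinct nodes `u` to get distinct rows.
    let t : F.U₁ → Finset (Fin M) := fun u => s.filter fun j =>
      j = e (Sum.inl u) ∨ ∃ v, (u, v) ∈ F.E ∧ j = e (Sum.inr v)
    have key : ∀ u, ∃ i, s ∩ row i = t u := by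
      intro u
      obtain ⟨B, hB, hBt⟩ := hs (t := t u) (Finset.filter_subset _ _)
      obtain ⟨i, -, rfl⟩ := Finset.mem_image.1 hB
      exact ⟨i, hBt⟩
    choose f hf using key
    have hmem : ∀ u (j : s), A (f u) j = 1 ↔
        j = e (Sum.inl u) ∨ ∃ v, (u, v) ∈ F.E ∧ j = e (Sum.inr v) := by
      intro u j
      have h1 : (j : Fin M) ∈ s ∩ row (f u) ↔ (j : Fin M) ∈ t u := by rw [hf]
      rw [Finset.mem_inter, mem_row, Finset.mem_filter, and_iff_right j.2, and_iff_right j.2] at h1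
      simpa only [Subtype.val_inj] using h1
    have hfinj : Function.Injective f := by
      intro u u' h
      have h1 : A (f u) (e (Sum.inl u)) = 1 := (hmem u _).2 (Or.inl rfl)
      rw [h, hmem] at h1
      rcases h1 with h1 | ⟨v, -, h1⟩
      · exact Sum.inl_injective (e.injective h1)
      · exact absurd (e.injective h1) Sum.inl_ne_inr
    have hedge : ∀ u v, A (f u) (e (Sum.inr v)) = 1 ↔ (u, v) ∈ F.E := by
      intro u v
      rw [hmem]
      simp
    have h0 := hF f (fun v => e (Sum.inr v)) hfinj
      (Subtype.val_injective.comp (e.injective.comp Sum.inr_injective))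
    rw [inducedDensityAt, mul_eq_zero, Finset.prod_eq_zero_iff, Finset.prod_eq_zero_iff] at h0
    rcases h0 with ⟨p, hp, h0⟩ | ⟨p, hp, h0⟩
    · rw [(hedge p.1 p.2).2 hp] at h0
      exact one_ne_zero h0
    · have hp' : p ∉ F.E := by simpa using hp
      exact hp' ((hedge p.1 p.2).1 (by linarith))
  calc Fintype.card ι = (Finset.univ.image row).card := by
        rw [Finset.card_image_of_injective _ hrow, Finset.card_univ]
    _ ≤ _ := Finset.card_le_card_shatterer _
    _ ≤ _ := Finset.card_shatterer_le_sum_vcDim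
    _ ≤ ∑ i ∈ Finset.Iic F.numNodes, M.choose i := by
        simp only [Fintype.card_fin]
        exact Finset.sum_le_sum_of_subset (Finset.Iic_subset_Iic.2 hvc)
    -- This is the binomial expansion of `(M + 1) ^ k`, compared term by term.
    _ ≤ ∑ i ∈ Finset.range (F.numNodes + 1), M ^ i * 1 ^ (F.numNodes - i) *
          F.numNodes.choose i := by
        rw [← Nat.range_succ_eq_Iic]
        refine Finset.sum_le_sum fun i hi => ?_
        have h1 : 0 < F.numNodes.choose i :=
          Nat.choose_pos (Nat.lt_succ_iff.1 (Finset.mem_range.1 hi))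
        calc M.choose i ≤ M ^ i := Nat.choose_le_pow M i
          _ ≤ _ := by rw [one_pow, mul_one]; exact Nat.le_mul_of_pos_right _ h1
    _ = (M + 1) ^ F.numNodes := by rw [add_pow]; simp

/-! ### Product measures, and zero-one values from vanishing density. -/

/-- Reindexing a product of copies of a probability space along an injective map preserves the
product measure. -/
theorem measurePreserving_pi_comp_injective {α ι κ : Type*} [Fintype ι] [Fintype κ]
    [MeasurableSpace α] (μ : Measure α) [IsProbabilityMeasure μ] {f : ι → κ}
    (hf : Function.Injective f) :
    MeasurePreserving (fun x : κ → α => fun i => x (f i))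
      (Measure.pi fun _ => μ) (Measure.pi fun _ => μ) := by
  classical
  refine ⟨by fun_prop, (Measure.pi_eq fun s hs => ?_).symm⟩
  rw [Measure.map_apply (by fun_prop) (MeasurableSet.univ_pi hs)]
  have hpre : (fun x : κ → α => fun i => x (f i)) ⁻¹' (Set.univ.pi s) =
      Set.univ.pi fun k => ⋂ i, ⋂ _ : f i = k, s i := by
    ext x
    simp only [Set.mem_preimage, Set.mem_univ_pi, Set.mem_iInter]
    exact ⟨fun h k i hi => hi ▸ h i, fun h i => h _ i rfl⟩
  have hval : ∀ i, (⋂ i', ⋂ _ : f i' = f i, s i') = s i := fun i => by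
    ext a
    simp only [Set.mem_iInter]
    exact ⟨fun h => h i rfl, fun h i' hi' => hf hi' ▸ h⟩
  rw [hpre, Measure.pi_pi, ← Finset.prod_subset (Finset.subset_univ (Finset.univ.image f)),
    Finset.prod_image hf.injOn]
  · simp only [hval]
  · intro k _ hk
    have : (⋂ i, ⋂ _ : f i = k, s i) = Set.univ := by
      ext a
      simp only [Set.mem_iInter, Set.mem_univ, iff_true]
      exact fun i hi => absurd (Finset.mem_image.2 ⟨i, Finset.mem_univ _, hi⟩) hk
    rw [this, measure_univ]

/-- If almost every `ι × κ` grid has a vertex outside `S`, then `S` is null. -/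
theorem measure_eq_zero_of_ae_grid_not_subset {α β ι κ : Type*} [Fintype ι] [Fintype κ]
    [MeasurableSpace α] [MeasurableSpace β] (μ : Measure α) (ν : Measure β)
    [IsProbabilityMeasure μ] [IsProbabilityMeasure ν] {S : Set (α × β)} (hS : MeasurableSet S)
    (h : ∀ᵐ p : (ι → α) × (κ → β) ∂((Measure.pi fun _ => μ).prod (Measure.pi fun _ => ν)),
      ¬ ∀ i j, (p.1 i, p.2 j) ∈ S) :
    μ.prod ν S = 0 := by
  -- For fixed `y` the set of `x` completing a grid in `S` is a power of one set, so nullity passes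
  -- to its base. The same argument in the other variable then reduces grids to single points.
  have h1 : ∀ᵐ y : κ → β ∂(Measure.pi fun _ => ν), μ {a | ∀ j, (a, y j) ∈ S} = 0 := by
    have h' := Measure.ae_ae_of_ae_prod
      ((Measure.measurePreserving_swap (μ := Measure.pi fun _ : κ => ν)
        (ν := Measure.pi fun _ : ι => μ)).quasiMeasurePreserving.ae h)
    filter_upwards [h'] with y hy
    rw [ae_iff] at hy
    have : {x : ι → α | ¬¬∀ i j, ((y, x).swap.1 i, (y, x).swap.2 j) ∈ S} =
        Set.univ.pi fun _ : ι => {a | ∀ j, (a, y j) ∈ S} := by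
      ext x; simp
    rw [this, Measure.pi_pi, Finset.prod_const] at hy
    exact eq_zero_of_pow_eq_zero hy
  have hmeas : MeasurableSet {p : α × (κ → β) | ∀ j, (p.1, p.2 j) ∈ S} := by
    rw [Set.ofPred_forall]
    exact MeasurableSet.iInter fun j => hS.preimage (by fun_prop)
  have h2 : ∀ᵐ a ∂μ, (Measure.pi fun _ : κ => ν) {y | ∀ j, (a, y j) ∈ S} = 0 := by
    have h0 : ((Measure.pi fun _ : κ => ν).prod μ)
        {p : (κ → β) × α | ∀ j, (p.2, p.1 j) ∈ S} = 0 :=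
      (Measure.measure_prod_null (hmeas.preimage measurable_swap)).2 h1
    have h3 : ∀ᵐ q ∂((Measure.pi fun _ : κ => ν).prod μ),
        ¬ ∀ j, (q.2, q.1 j) ∈ S := by
      rw [ae_iff]; simpa using h0
    have h4 := Measure.ae_ae_of_ae_prod
      ((Measure.measurePreserving_swap (μ := μ)
        (ν := Measure.pi fun _ : κ => ν)).quasiMeasurePreserving.ae h3)
    filter_upwards [h4] with a ha
    rw [ae_iff] at ha
    simpa using ha
  rw [Measure.measure_prod_null hS]
  filter_upwards [h2] with a ha
  have : {y : κ → β | ∀ j, (a, y j) ∈ S} = Set.univ.pi fun _ : κ => Prod.mk a ⁻¹' S := by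
    ext y; simp
  rw [this, Measure.pi_pi, Finset.prod_const] at ha
  exact eq_zero_of_pow_eq_zero ha

theorem inducedDensityAt_mem_Icc {J₁ J₂ : Type*} (F : Bigraph) {W : J₁ → J₂ → ℝ}
    (hW : ∀ x y, W x y ∈ Set.Icc (0 : ℝ) 1)
    (x : F.U₁ → J₁) (y : F.U₂ → J₂) : inducedDensityAt F W x y ∈ Set.Icc (0 : ℝ) 1 := by
  have h0 : ∀ x y, 0 ≤ W x y := fun x y => (hW x y).1
  have h1 : ∀ x y, 0 ≤ 1 - W x y := fun x y => sub_nonneg.2 (hW x y).2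
  refine ⟨mul_nonneg (Finset.prod_nonneg fun _ _ => h0 _ _)
    (Finset.prod_nonneg fun _ _ => h1 _ _), mul_le_one₀ ?_ ?_ ?_⟩
  · exact Finset.prod_le_one (fun _ _ => h0 _ _) fun _ _ => (hW _ _).2
  · exact Finset.prod_nonneg fun _ _ => h1 _ _
  · exact Finset.prod_le_one (fun _ _ => h1 _ _) fun _ _ => sub_le_self _ (h0 _ _)

section
variable {J₁ J₂ : Type*} [MeasurableSpace J₁] [MeasurableSpace J₂]
  {π₁ : Measure J₁} {π₂ : Measure J₂} [IsProbabilityMeasure π₁] [IsProbabilityMeasure π₂]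
  {W : J₁ → J₂ → ℝ}

/-- Evaluating at one node on each side preserves the product measures. -/
theorem measurePreserving_eval_prod_eval {ι κ : Type*} [Fintype ι] [Fintype κ] (i : ι) (j : κ) :
    MeasurePreserving (fun p : (ι → J₁) × (κ → J₂) => (p.1 i, p.2 j))
      ((Measure.pi fun _ => π₁).prod (Measure.pi fun _ => π₂)) (π₁.prod π₂) :=
  (measurePreserving_eval (fun _ => π₁) i).prod (measurePreserving_eval (fun _ => π₂) j)

theorem aemeasurable_inducedDensityAt (F : Bigraph)
    (hW : AEMeasurable (Function.uncurry W) (π₁.prod π₂)) :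
    AEMeasurable (fun p : (F.U₁ → J₁) × (F.U₂ → J₂) => inducedDensityAt F W p.1 p.2)
      ((Measure.pi fun _ => π₁).prod (Measure.pi fun _ => π₂)) := by
  have h : ∀ i j, AEMeasurable (fun p : (F.U₁ → J₁) × (F.U₂ → J₂) => W (p.1 i) (p.2 j))
      ((Measure.pi fun _ => π₁).prod (Measure.pi fun _ => π₂)) := fun i j =>
    hW.comp_quasiMeasurePreserving
      (measurePreserving_eval_prod_eval (π₁ := π₁) (π₂ := π₂) i j).quasiMeasurePreserving
  unfold inducedDensityAt
  exact (Finset.aemeasurable_fun_prod _ fun _ _ => h _ _).mul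
    (Finset.aemeasurable_fun_prod _ fun _ _ => (h _ _).const_sub 1)

/-- The induced density vanishes only if its integrand vanishes almost everywhere. -/
theorem ae_inducedDensityAt_eq_zero (F : Bigraph) (hW : IsBigraphon π₁ π₂ W)
    (hF : inducedDensity π₁ π₂ F W = 0) :
    ∀ᵐ p : (F.U₁ → J₁) × (F.U₂ → J₂) ∂((Measure.pi fun _ => π₁).prod (Measure.pi fun _ => π₂)),
      inducedDensityAt F W p.1 p.2 = 0 := by
  have hint : Integrable (fun p : (F.U₁ → J₁) × (F.U₂ → J₂) => inducedDensityAt F W p.1 p.2)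
      ((Measure.pi fun _ => π₁).prod (Measure.pi fun _ => π₂)) := by
    refine Integrable.of_bound (aemeasurable_inducedDensityAt F hW.aemeasurable).aestronglyMeasurable
      1 (Eventually.of_forall fun p => ?_)
    have := inducedDensityAt_mem_Icc F hW.mem_Icc p.1 p.2
    rw [Real.norm_of_nonneg this.1]
    exact this.2
  have h0 := integral_prod _ hint
  rw [show (∫ x, ∫ y, inducedDensityAt F W (x, y).1 (x, y).2 ∂(Measure.pi fun _ => π₂)
    ∂(Measure.pi fun _ => π₁)) = 0 from hF] at h0
  exact (integral_eq_zero_iff_of_nonneg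
    (fun p : (F.U₁ → J₁) × (F.U₂ → J₂) => (inducedDensityAt_mem_Icc F hW.mem_Icc p.1 p.2).1) hint).1 h0

/-- A bigraphon in which `F` has induced density zero is `0/1`-valued almost everywhere. -/
theorem ae_eq_zero_or_one_of_ae_inducedDensityAt (F : Bigraph) (hW : IsBigraphon π₁ π₂ W)
    (hF : ∀ᵐ p : (F.U₁ → J₁) × (F.U₂ → J₂)
      ∂((Measure.pi fun _ => π₁).prod (Measure.pi fun _ => π₂)),
        inducedDensityAt F W p.1 p.2 = 0) :
    ∀ᵐ p ∂(π₁.prod π₂), W p.1 p.2 = 0 ∨ W p.1 p.2 = 1 := by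
  -- The grid lemma needs a measurable set, so `W` is replaced by a measurable representative.
  set W' := hW.aemeasurable.mk _ with hW'
  have hae : ∀ᵐ p ∂(π₁.prod π₂), W p.1 p.2 = W' p := hW.aemeasurable.ae_eq_mk
  have hmeas : MeasurableSet (W' ⁻¹' Set.Ioo 0 1) :=
    hW.aemeasurable.measurable_mk measurableSet_Ioo
  have hnull : π₁.prod π₂ (W' ⁻¹' Set.Ioo 0 1) = 0 := by
    refine measure_eq_zero_of_ae_grid_not_subset (ι := F.U₁) (κ := F.U₂) π₁ π₂ hmeas ?_
    have hall : ∀ᵐ p : (F.U₁ → J₁) × (F.U₂ → J₂)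
        ∂((Measure.pi fun _ => π₁).prod (Measure.pi fun _ => π₂)),
        ∀ i j, W (p.1 i) (p.2 j) = W' (p.1 i, p.2 j) :=
      ae_all_iff.2 fun i => ae_all_iff.2 fun j =>
        (measurePreserving_eval_prod_eval i j).quasiMeasurePreserving.ae hae
    filter_upwards [hF, hall] with p hp hall hS
    have hS' : ∀ i j, W (p.1 i) (p.2 j) ∈ Set.Ioo (0 : ℝ) 1 := fun i j => by
      rw [hall]; exact hS i j
    refine (mul_pos (Finset.prod_pos fun q _ => (hS' q.1 q.2).1)
      (Finset.prod_pos fun q _ => sub_pos.2 (hS' q.1 q.2).2)).ne' hp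
  have hnull' : ∀ᵐ p ∂(π₁.prod π₂), W' p ∉ Set.Ioo (0 : ℝ) 1 := measure_eq_zero_iff_ae_notMem.1 hnull
  filter_upwards [hae, hnull'] with p hp hp'
  rw [← hp] at hp'
  have := hW.mem_Icc p.1 p.2
  by_contra! hne
  exact hp' ⟨lt_of_le_of_ne this.1 hne.1.symm, lt_of_le_of_ne this.2 hne.2⟩

end

/-! ### Random columns and the polynomial packing bound. -/

/-- Two sections at distance `r` agree on a set of measure at most `1 - r`. -/
theorem measure_section_eq_le {J₁ J₂ : Type*} [MeasurableSpace J₂] {π₂ : Measure J₂}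
    [IsProbabilityMeasure π₂] {W : J₁ → J₂ → ℝ} (hW : ∀ x y, W x y ∈ Set.Icc (0 : ℝ) 1)
    (hsec : ∀ x, AEMeasurable (fun y => W x y) π₂) (x x' : J₁) :
    π₂ {z | W x z = W x' z} ≤ ENNReal.ofReal (1 - nbhdDist₁ π₂ W x x') := by
  have hnm : NullMeasurableSet {z | W x z = W x' z} π₂ :=
    nullMeasurableSet_eq_fun (hsec x) (hsec x')
  have hle : nbhdDist₁ π₂ W x x' ≤ π₂.real {z | W x z = W x' z}ᶜ := by
    have hone : ∫ z, {z | W x z = W x' z}ᶜ.indicator (1 : J₂ → ℝ) z ∂π₂ =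
        π₂.real {z | W x z = W x' z}ᶜ := by
      rw [integral_indicator₀ hnm.compl]
      simp
    rw [← hone]
    refine integral_mono_of_nonneg (Eventually.of_forall fun z => abs_nonneg _) ?_
      (Eventually.of_forall fun z => ?_)
    · exact (integrable_const (1 : ℝ)).indicator₀ hnm.compl
    · by_cases hz : W x z = W x' z
      · simp [hz]
      · simp only [Set.mem_compl_iff, Set.mem_ofPred_eq, hz, not_false_eq_true,
          Set.indicator_of_mem, Pi.one_apply]
        have h1 := hW x z
        have h2 := hW x' z
        exact abs_le.2 ⟨by linarith [h1.1, h2.2], by linarith [h1.2, h2.1]⟩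
  rw [probReal_compl_eq_one_sub₀ hnm] at hle
  rw [← ofReal_measureReal]
  exact ENNReal.ofReal_le_ofReal (by linarith)

/-- If every two of finitely many points of `J₁` are likely enough to be told apart by `M` random
columns, then some almost sure event about `M` columns occurs together with all the points being
told apart. -/
theorem exists_sample_injective {J₁ J₂ : Type*} [MeasurableSpace J₁] [MeasurableSpace J₂]
    [MetricSpace J₁] [MetricSpace J₂] {π₁ : Measure J₁} {π₂ : Measure J₂}
    [IsProbabilityMeasure π₂] {W : J₁ → J₂ → ℝ}
    (hW : IsPureBigraphon π₁ π₂ W) {ι : Type*} [Fintype ι]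
    (x : ι → J₁) {δ : ℝ} (hδ : δ ≤ 1) (hx : Pairwise fun i i' => δ ≤ dist (x i) (x i')) {M : ℕ}
    (hM : (Fintype.card ι : ℝ) ^ 2 * (1 - δ) ^ M < 1) {P : (Fin M → J₂) → Prop}
    (hP : ∀ᵐ y ∂(Measure.pi fun _ : Fin M => π₂), P y) :
    ∃ y, P y ∧ Function.Injective fun i j => W (x i) (y j) := by
  classical
  -- Union bound over ordered pairs, whence the factor `card ι ^ 2`.
  let bad : Set (Fin M → J₂) := ⋃ q ∈ (Finset.univ.filter fun q : ι × ι => q.1 ≠ q.2),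
    Set.univ.pi fun _ => {z | W (x q.1) z = W (x q.2) z}
  have hbad : (Measure.pi fun _ : Fin M => π₂) bad < 1 := by
    calc (Measure.pi fun _ : Fin M => π₂) bad
        ≤ ∑ q ∈ (Finset.univ.filter fun q : ι × ι => q.1 ≠ q.2),
            (Measure.pi fun _ : Fin M => π₂)
              (Set.univ.pi fun _ => {z | W (x q.1) z = W (x q.2) z}) :=
          measure_biUnion_finset_le _ _
      _ ≤ ∑ q ∈ (Finset.univ.filter fun q : ι × ι => q.1 ≠ q.2), ENNReal.ofReal (1 - δ) ^ M := by
          refine Finset.sum_le_sum fun q hq => ?_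
          rw [Measure.pi_pi, Finset.prod_const, Finset.card_univ, Fintype.card_fin]
          refine pow_le_pow_left' ((measure_section_eq_le hW.mem_Icc hW.section₁ _ _).trans ?_) M
          rw [← hW.dist_eq₁]
          have := hx (Finset.mem_filter.1 hq).2
          exact ENNReal.ofReal_le_ofReal (by linarith)
      _ ≤ ∑ q : ι × ι, ENNReal.ofReal (1 - δ) ^ M :=
          Finset.sum_le_sum_of_subset (Finset.filter_subset _ _)
      _ = ENNReal.ofReal ((Fintype.card ι : ℝ) ^ 2 * (1 - δ) ^ M) := by
          rw [ENNReal.ofReal_mul (by positivity), ENNReal.ofReal_pow (sub_nonneg.2 hδ)]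
          simp [sq]
      _ < 1 := by rwa [ENNReal.ofReal_lt_one]
  have hfreq : ∃ᵐ y ∂(Measure.pi fun _ : Fin M => π₂), y ∉ bad := by
    intro h
    refine hbad.ne ?_
    have h' : ∀ᵐ y ∂(Measure.pi fun _ : Fin M => π₂), y ∈ bad := by simpa using h
    exact (measure_congr (eventuallyEq_univ.2 h')).trans measure_univ
  obtain ⟨y, hy, hPy⟩ := (hfreq.and_eventually hP).exists
  refine ⟨y, hPy, fun i i' h => ?_⟩
  by_contra hne
  refine hy (Set.mem_biUnion (x := (i, i')) (by simpa using hne) ?_)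
  exact fun j _ => congrFun h j

section
variable {J₁ J₂ : Type*} [MeasurableSpace J₁] [MeasurableSpace J₂]
  [MetricSpace J₁] [MetricSpace J₂]
  {π₁ : Measure J₁} {π₂ : Measure J₂} [IsProbabilityMeasure π₁] [IsProbabilityMeasure π₂]
  {W : J₁ → J₂ → ℝ}

/-- A finite family of points of `J₁` can be moved slightly so that almost every sample of columns
is `0/1`-valued on it and avoids induced copies of `F`. -/
theorem IsPureBigraphon.exists_generic_near (hW : IsPureBigraphon π₁ π₂ W) (F : Bigraph)
    (hF : ∀ᵐ p : (F.U₁ → J₁) × (F.U₂ → J₂)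
      ∂((Measure.pi fun _ => π₁).prod (Measure.pi fun _ => π₂)),
        inducedDensityAt F W p.1 p.2 = 0)
    {ι : Type*} [Fintype ι] (a : ι → J₁) {δ : ℝ} (hδ : 0 < δ) (M : ℕ) :
    ∃ x : ι → J₁, (∀ i, dist (x i) (a i) < δ) ∧
      ∀ᵐ y : Fin M → J₂ ∂(Measure.pi fun _ => π₂),
        (∀ i j, W (x i) (y j) = 0 ∨ W (x i) (y j) = 1) ∧
        ∀ (f : F.U₁ → ι) (g : F.U₂ → Fin M), Function.Injective f → Function.Injective g →
          inducedDensityAt F W (fun u => x (f u)) (fun v => y (g v)) = 0 := by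
  have h01 := ae_eq_zero_or_one_of_ae_inducedDensityAt F hW.toIsBigraphon hF
  have hgen : ∀ᵐ p : (ι → J₁) × (Fin M → J₂)
      ∂((Measure.pi fun _ => π₁).prod (Measure.pi fun _ => π₂)),
      (∀ i j, W (p.1 i) (p.2 j) = 0 ∨ W (p.1 i) (p.2 j) = 1) ∧
        ∀ (f : F.U₁ → ι) (g : F.U₂ → Fin M), Function.Injective f → Function.Injective g →
          inducedDensityAt F W (fun u => p.1 (f u)) (fun v => p.2 (g v)) = 0 := by
    refine Filter.Eventually.and ?_ ?_
    · exact ae_all_iff.2 fun i => ae_all_iff.2 fun j =>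
        (measurePreserving_eval_prod_eval i j).quasiMeasurePreserving.ae h01
    · refine ae_all_iff.2 fun f => ae_all_iff.2 fun g => ?_
      -- Injectivity is essential: repeated nodes would confine the sample to a diagonal, which may
      -- be null.
      by_cases hf : Function.Injective f
      · by_cases hg : Function.Injective g
        · filter_upwards [((measurePreserving_pi_comp_injective π₁ hf).prod
            (measurePreserving_pi_comp_injective π₂ hg)).quasiMeasurePreserving.ae hF] with p hp
          exact fun _ _ => hp
        · exact Eventually.of_forall fun _ _ h => absurd h hg
      · exact Eventually.of_forall fun _ h => absurd h hf
  -- Balls need not be measurable, since no Borel structure is assumed; positive outer measure is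
  -- enough to meet an almost sure event.
  have hpos : (Measure.pi fun _ : ι => π₁) (Set.univ.pi fun i => Metric.ball (a i) δ) ≠ 0 := by
    rw [Measure.pi_pi]
    exact Finset.prod_ne_zero_iff.2 fun i _ =>
      (hW.full_support₁ _ Metric.isOpen_ball ⟨a i, Metric.mem_ball_self hδ⟩).ne'
  obtain ⟨x, hx, hx'⟩ :=
    ((frequently_ae_mem_iff.2 hpos).and_eventually (Measure.ae_ae_of_ae_prod hgen)).exists
  exact ⟨x, fun i => hx i (Set.mem_univ i), hx'⟩

/-- Moving each point by less than `ε / 4` leaves separation `ε / 2`, so a sample that is both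
generic and row-separating exists, and the matrix bound applies to it. -/
theorem IsPureBigraphon.card_le_of_separated (hW : IsPureBigraphon π₁ π₂ W) (F : Bigraph)
    (hF : ∀ᵐ p : (F.U₁ → J₁) × (F.U₂ → J₂)
      ∂((Measure.pi fun _ => π₁).prod (Measure.pi fun _ => π₂)),
        inducedDensityAt F W p.1 p.2 = 0)
    {s : Finset J₁} {ε : ℝ} (hε : 0 < ε) (hε1 : ε ≤ 1)
    (hs : (s : Set J₁).Pairwise fun x y => ε ≤ dist x y) {M : ℕ}
    (hM : (s.card : ℝ) ^ 2 * (1 - ε / 2) ^ M < 1) :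
    s.card ≤ (M + 1) ^ F.numNodes := by
  obtain ⟨x, hxa, hx⟩ := hW.exists_generic_near F hF (fun i : s => (i : J₁))
    (show 0 < ε / 4 by linarith) M
  have hsep : Pairwise fun i i' => ε / 2 ≤ dist (x i) (x i') := by
    intro i i' hne
    have h1 := hs i.2 i'.2 (fun h => hne (Subtype.ext h))
    have h2 := dist_triangle4 (i : J₁) (x i) (x i') i'
    have h3 := hxa i
    have h4 := hxa i'
    rw [dist_comm] at h3
    linarith
  obtain ⟨y, ⟨h01, hind⟩, hinj⟩ := exists_sample_injective hW x (by linarith) hsep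
    (by simpa using hM) hx
  simpa using card_le_of_no_induced_copy F (fun i j => W (x i) (y j)) h01 hinj hind

/-- Polynomial packing bound. -/
theorem IsPureBigraphon.exists_card_le_rpow (hW : IsPureBigraphon π₁ π₂ W) (F : Bigraph)
    (hF : ∀ᵐ p : (F.U₁ → J₁) × (F.U₂ → J₂)
      ∂((Measure.pi fun _ => π₁).prod (Measure.pi fun _ => π₂)),
        inducedDensityAt F W p.1 p.2 = 0) (hk : 0 < F.numNodes) :
    ∃ C : ℝ, ∀ (ε : ℝ), 0 < ε → ε ≤ 1 → ∀ s : Finset J₁,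
      ((s : Set J₁).Pairwise fun x y => ε ≤ dist x y) →
      (s.card : ℝ) ≤ C * (1 / ε) ^ (2 * F.numNodes) := by
  set k := F.numNodes with hk'
  refine ⟨(8 * k + 3) ^ (2 * k), fun ε hε hε1 s hs => ?_⟩
  rcases s.eq_empty_or_nonempty with rfl | hne
  · simp only [Finset.card_empty, Nat.cast_zero]; positivity
  set N : ℝ := (s.card : ℝ) with hN
  have hN1 : 1 ≤ N := Nat.one_le_cast.2 hne.card_pos
  have hN0 : 0 < N := by linarith
  have hlog : 0 ≤ Real.log N := Real.log_nonneg hN1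
  have hkR : (0 : ℝ) < k := by exact_mod_cast hk
  -- Chosen so that `2 * log N < ε / 2 * M`, which beats the union bound; the `+ 1` makes the
  -- inequality strict.
  set M : ℕ := ⌊4 / ε * Real.log N⌋₊ + 1 with hMdef
  have hMgt : 4 / ε * Real.log N < M := by
    rw [hMdef]; push_cast; exact Nat.lt_floor_add_one _
  have hMle : (M : ℝ) ≤ 4 / ε * Real.log N + 1 := by
    rw [hMdef]; push_cast
    have := Nat.floor_le (show 0 ≤ 4 / ε * Real.log N by positivity)
    linarith
  have hM : N ^ 2 * (1 - ε / 2) ^ M < 1 := by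
    have h1 : (1 - ε / 2) ^ M ≤ Real.exp (-(ε / 2 * M)) := by
      calc (1 - ε / 2) ^ M ≤ Real.exp (-(ε / 2)) ^ M :=
            pow_le_pow_left₀ (by linarith) (Real.one_sub_le_exp_neg _) _
        _ = _ := by rw [← Real.exp_nat_mul]; congr 1; ring
    have h2 : N ^ 2 = Real.exp (2 * Real.log N) := by
      rw [two_mul, Real.exp_add, Real.exp_log hN0, sq]
    have h3 : 2 * Real.log N < ε / 2 * M := by
      calc 2 * Real.log N = ε / 2 * (4 / ε * Real.log N) := by field_simp; ring
        _ < _ := by gcongr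
    calc N ^ 2 * (1 - ε / 2) ^ M ≤ Real.exp (2 * Real.log N) * Real.exp (-(ε / 2 * M)) := by
          rw [h2]; gcongr
      _ = Real.exp (2 * Real.log N - ε / 2 * M) := by rw [← Real.exp_add]; rfl
      _ < 1 := (Real.exp_lt_exp.2 (by linarith)).trans_eq Real.exp_zero
  have hcard : N ≤ ((M : ℝ) + 1) ^ k := by
    have := hW.card_le_of_separated F hF hε hε1 hs hM
    rw [hN]
    exact_mod_cast this
  -- As `log N ≤ 2 * k * R`, the bound on `N = R ^ (2 * k)` has only `R ^ k` on its right;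
  -- cancelling `R ^ k` and squaring finishes.
  set R : ℝ := N ^ (1 / (2 * k : ℝ)) with hR
  have hR1 : 1 ≤ R := Real.one_le_rpow hN1 (by positivity)
  have hRk : R ^ k * R ^ k = N := by
    rw [← pow_add, ← two_mul, hR, ← Real.rpow_natCast, ← Real.rpow_mul hN0.le]
    push_cast
    rw [one_div_mul_cancel (by positivity), Real.rpow_one]
  have hlogR : Real.log N ≤ 2 * k * R := by
    have := Real.log_le_rpow_div hN0.le (show 0 < 1 / (2 * k : ℝ) by positivity)
    rw [← hR] at this
    calc Real.log N ≤ R / (1 / (2 * k)) := this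
      _ = 2 * k * R := by field_simp
  have hinv : 1 ≤ 1 / ε := by rw [le_div_iff₀ hε]; linarith
  have hM1 : (M : ℝ) + 1 ≤ (8 * k + 3) * (1 / ε) * R := by
    have h1 : 4 / ε * Real.log N ≤ 4 / ε * (2 * k * R) := by gcongr
    have h2 : 1 ≤ 1 / ε * R := one_le_mul_of_one_le_of_one_le hinv hR1
    have h3 : (8 * k + 3) * (1 / ε) * R = 4 / ε * (2 * k * R) + 3 * (1 / ε * R) := by ring
    linarith
  have hbound : R ^ k * R ^ k ≤ ((8 * k + 3) * (1 / ε)) ^ k * R ^ k := by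
    rw [hRk, ← mul_pow]
    exact hcard.trans (pow_le_pow_left₀ (by positivity) hM1 _)
  have hRle : R ^ k ≤ ((8 * k + 3) * (1 / ε)) ^ k := le_of_mul_le_mul_right hbound (by positivity)
  calc N = R ^ k * R ^ k := hRk.symm
    _ ≤ ((8 * k + 3) * (1 / ε)) ^ k * ((8 * k + 3) * (1 / ε)) ^ k := by gcongr
    _ = _ := by rw [← pow_add, ← two_mul, mul_pow]

end

/-! ### From packing numbers to total boundedness and dimension. -/

section Dimension

variable {X : Type*} [MetricSpace X]

/-- A separated set of maximal cardinality is a net: any uncovered point could be added to it. -/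
theorem totallyBounded_univ_of_card_le
    (h : ∀ ε : ℝ, 0 < ε → ε ≤ 1 → ∃ n : ℕ, ∀ s : Finset X,
      ((s : Set X).Pairwise fun x y => ε ≤ dist x y) → s.card ≤ n) :
    TotallyBounded (Set.univ : Set X) := by
  classical
  refine Metric.totallyBounded_iff.2 fun ε hε => ?_
  obtain ⟨n, hn⟩ := h (min ε 1) (by positivity) (min_le_right _ _)
  let S : Set ℕ := {m | ∃ s : Finset X,
    ((s : Set X).Pairwise fun x y => min ε 1 ≤ dist x y) ∧ s.card = m}
  have hSne : S.Nonempty := ⟨0, ∅, by simp, rfl⟩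
  have hSbdd : BddAbove S := ⟨n, by rintro m ⟨s, hs, rfl⟩; exact hn s hs⟩
  obtain ⟨s, hs, hcard⟩ := Nat.sSup_mem hSne hSbdd
  refine ⟨s, s.finite_toSet, fun x _ => ?_⟩
  by_contra hx
  have hx' : ∀ y ∈ s, ε ≤ dist x y := by simpa using hx
  have hxs : x ∉ s := fun hmem => by simpa using (hx' x hmem).trans_lt' hε
  have hins : ((insert x s : Finset X) : Set X).Pairwise fun x y => min ε 1 ≤ dist x y := by
    rw [Finset.coe_insert, Set.pairwise_insert]
    refine ⟨hs, fun y hy _ => ⟨(min_le_left _ _).trans (hx' y hy), ?_⟩⟩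
    rw [dist_comm]
    exact (min_le_left _ _).trans (hx' y hy)
  have := le_csSup hSbdd ⟨_, hins, rfl⟩
  rw [Finset.card_insert_of_notMem hxs, hcard] at this
  omega

theorem upperPackingDim_le_of_card_le {C : ℝ} {d : ℕ}
    (h : ∀ ε : ℝ, 0 < ε → ε ≤ 1 → ∀ s : Finset X,
      ((s : Set X).Pairwise fun x y => ε ≤ dist x y) → (s.card : ℝ) ≤ C * (1 / ε) ^ d) :
    upperPackingDim X ≤ ((d + 1 : ℕ) : EReal) := by
  refine limsup_le_of_le (by isBoundedDefault) ?_
  have h1 : ∀ᶠ ε : ℝ in 𝓝[>] 0, C ≤ 1 / ε := by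
    simpa only [one_div] using tendsto_inv_nhdsGT_zero.eventually_ge_atTop C
  -- The constant `C` is absorbed into one extra factor `1 / ε`, which is why the bound reads `d +
  -- 1`.
  filter_upwards [h1, Ioo_mem_nhdsGT (show (0 : ℝ) < 1 by norm_num)] with ε hC hε
  have hlog : 0 < Real.log (1 / ε) := Real.log_pos (by rw [lt_div_iff₀ hε.1]; linarith [hε.2])
  have hpos : 0 < 1 / ε := one_div_pos.2 hε.1
  rw [EReal.div_le_iff_le_mul (by exact_mod_cast hlog) (EReal.coe_ne_top _)]
  have hsep : (sepNumber X ε : ENNReal) ≤ ENNReal.ofReal ((1 / ε) ^ (d + 1)) := by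
    have hb : sepNumber X ε ≤ (⌊(1 / ε) ^ (d + 1)⌋₊ : ℕ∞) := by
      refine iSup₂_le fun s hs => ?_
      refine Nat.cast_le.2 (Nat.le_floor ((h ε hε.1 hε.2.le s hs).trans ?_))
      rw [pow_succ']
      gcongr
    calc (sepNumber X ε : ENNReal) ≤ ((⌊(1 / ε) ^ (d + 1)⌋₊ : ℕ∞) : ENNReal) := by
          exact_mod_cast hb
      _ = ENNReal.ofReal (⌊(1 / ε) ^ (d + 1)⌋₊ : ℝ) := by simp
      _ ≤ _ := ENNReal.ofReal_le_ofReal (Nat.floor_le (by positivity))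
  calc ENNReal.log (sepNumber X ε : ENNReal)
      ≤ ENNReal.log (ENNReal.ofReal ((1 / ε) ^ (d + 1))) := ENNReal.log_monotone hsep
    _ = (Real.log ((1 / ε) ^ (d + 1)) : EReal) := by
        rw [ENNReal.log_ofReal_of_pos (by positivity)]
    _ = _ := by
        rw [Real.log_pow, EReal.coe_mul]
        simp [mul_comm]

end Dimension

/-! ### Symmetry between the two sides, and conclusion. -/

/-- The bigraph with the two classes interchanged. -/
def Bigraph.swap (F : Bigraph) : Bigraph where
  U₁ := F.U₂
  U₂ := F.U₁
  E := F.E.map (Equiv.prodComm F.U₁ F.U₂).toEmbedding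

theorem Bigraph.numNodes_swap (F : Bigraph) : F.swap.numNodes = F.numNodes :=
  Nat.add_comm _ _

theorem inducedDensityAt_swap {J₁ J₂ : Type*} (F : Bigraph) (W : J₁ → J₂ → ℝ)
    (x : F.U₁ → J₁) (y : F.U₂ → J₂) :
    inducedDensityAt F.swap (fun b a => W a b) y x = inducedDensityAt F W x y := by
  classical
  have hcompl : (F.E.map (Equiv.prodComm F.U₁ F.U₂).toEmbedding)ᶜ =
      F.Eᶜ.map (Equiv.prodComm F.U₁ F.U₂).toEmbedding := by
    ext p
    simp
  unfold inducedDensityAt Bigraph.swap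
  congr 1
  · simp
  · have h := Finset.prod_map F.Eᶜ (Equiv.prodComm F.U₁ F.U₂).toEmbedding
      (fun p => 1 - W (x p.2) (y p.1))
    rw [← hcompl] at h
    convert h <;> rfl

/-- The empty bigraph has integrand `1`. Positivity is needed to divide by `2 * k` and for `2 * k +
1 ≤ 10 * k`. -/
theorem Bigraph.numNodes_pos_of_inducedDensityAt_eq_zero {J₁ J₂ : Type*} {F : Bigraph}
    {W : J₁ → J₂ → ℝ} {x : F.U₁ → J₁} {y : F.U₂ → J₂} (h : inducedDensityAt F W x y = 0) :
    0 < F.numNodes := by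
  by_contra! hk
  have : IsEmpty F.U₁ := Fintype.card_eq_zero_iff.1 (by unfold Bigraph.numNodes at hk; omega)
  rw [inducedDensityAt, Finset.prod_of_isEmpty, Finset.prod_of_isEmpty, one_mul] at h
  exact one_ne_zero h

section
variable {J₁ J₂ : Type*} [MeasurableSpace J₁] [MeasurableSpace J₂]
  [MetricSpace J₁] [MetricSpace J₂]
  {π₁ : Measure J₁} {π₂ : Measure J₂} [IsProbabilityMeasure π₁] [IsProbabilityMeasure π₂]
  {W : J₁ → J₂ → ℝ}

theorem IsPureBigraphon.swap (hW : IsPureBigraphon π₁ π₂ W) :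
    IsPureBigraphon π₂ π₁ fun y x => W x y where
  aemeasurable := hW.aemeasurable.comp_quasiMeasurePreserving
    Measure.measurePreserving_swap.quasiMeasurePreserving
  mem_Icc y x := hW.mem_Icc x y
  section₁ := hW.section₂
  section₂ := hW.section₁
  dist_eq₁ := hW.dist_eq₂
  dist_eq₂ := hW.dist_eq₁
  complete₁ := hW.complete₂
  complete₂ := hW.complete₁
  separable₁ := hW.separable₂
  separable₂ := hW.separable₁
  full_support₁ := hW.full_support₂
  full_support₂ := hW.full_support₁

/-- Compactness and the dimension bound for the first side of a pure bigraphon. -/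
theorem IsPureBigraphon.compactSpace_and_upperPackingDim_le (hW : IsPureBigraphon π₁ π₂ W)
    (F : Bigraph)
    (hF : ∀ᵐ p : (F.U₁ → J₁) × (F.U₂ → J₂)
      ∂((Measure.pi fun _ => π₁).prod (Measure.pi fun _ => π₂)),
        inducedDensityAt F W p.1 p.2 = 0) :
    CompactSpace J₁ ∧ upperPackingDim J₁ ≤ ((10 * F.numNodes : ℕ) : EReal) := by
  obtain ⟨p, hp⟩ := hF.exists
  have hk := Bigraph.numNodes_pos_of_inducedDensityAt_eq_zero hp
  obtain ⟨C, hC⟩ := hW.exists_card_le_rpow F hF hk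
  constructor
  · have := hW.complete₁
    refine isCompact_univ_iff.1 (isCompact_iff_totallyBounded_isComplete.2
      ⟨totallyBounded_univ_of_card_le fun ε hε hε1 => ?_, completeSpace_iff_isComplete_univ.1 this⟩)
    exact ⟨_, fun s hs => Nat.le_floor (hC ε hε hε1 s hs)⟩
  · refine (upperPackingDim_le_of_card_le hC).trans ?_
    have : 2 * F.numNodes + 1 ≤ 10 * F.numNodes := by omega
    exact_mod_cast this

theorem IsPureBigraphon.ae_inducedDensityAt_swap_eq_zero (hW : IsPureBigraphon π₁ π₂ W)
    {F : Bigraph} (hF : inducedDensity π₁ π₂ F W = 0) :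
    ∀ᵐ p : (F.swap.U₁ → J₂) × (F.swap.U₂ → J₁)
      ∂((Measure.pi fun _ => π₂).prod (Measure.pi fun _ => π₁)),
        inducedDensityAt F.swap (fun y x => W x y) p.1 p.2 = 0 := by
  have h := (Measure.measurePreserving_swap (μ := Measure.pi fun _ : F.U₂ => π₂)
    (ν := Measure.pi fun _ : F.U₁ => π₁)).quasiMeasurePreserving.ae
      (ae_inducedDensityAt_eq_zero F hW.toIsBigraphon hF)
  filter_upwards [h] with p hp
  rw [inducedDensityAt_swap F W p.2 p.1]
  exact hp

end

theorem theorem3p6 {J₁ J₂ : Type*} [MeasurableSpace J₁] [MeasurableSpace J₂]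
    [MetricSpace J₁] [MetricSpace J₂]
    (π₁ : Measure J₁) (π₂ : Measure J₂) [IsProbabilityMeasure π₁] [IsProbabilityMeasure π₂]
    (W : J₁ → J₂ → ℝ) (hW : IsPureBigraphon π₁ π₂ W) (hthin : IsThin π₁ π₂ W) :
    (∀ᵐ p ∂(π₁.prod π₂), W p.1 p.2 = 0 ∨ W p.1 p.2 = 1) ∧
    (CompactSpace J₁ ∧ CompactSpace J₂) ∧
    (upperPackingDim J₁ < ⊤ ∧ upperPackingDim J₂ < ⊤) ∧
    (∀ F : Bigraph, inducedDensity π₁ π₂ F W = 0 →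
      upperPackingDim J₁ ≤ ((10 * F.numNodes : ℕ) : EReal) ∧
      upperPackingDim J₂ ≤ ((10 * F.numNodes : ℕ) : EReal)) := by
  have key₁ : ∀ F : Bigraph, inducedDensity π₁ π₂ F W = 0 →
      CompactSpace J₁ ∧ upperPackingDim J₁ ≤ ((10 * F.numNodes : ℕ) : EReal) := fun F hF =>
    hW.compactSpace_and_upperPackingDim_le F (ae_inducedDensityAt_eq_zero F hW.toIsBigraphon hF)
  have key₂ : ∀ F : Bigraph, inducedDensity π₁ π₂ F W = 0 →
      CompactSpace J₂ ∧ upperPackingDim J₂ ≤ ((10 * F.numNodes : ℕ) : EReal) := fun F hF => by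
    rw [← F.numNodes_swap]
    exact hW.swap.compactSpace_and_upperPackingDim_le F.swap
      (hW.ae_inducedDensityAt_swap_eq_zero hF)
  obtain ⟨F, hF⟩ := hthin
  refine ⟨ae_eq_zero_or_one_of_ae_inducedDensityAt F hW.toIsBigraphon
    (ae_inducedDensityAt_eq_zero F hW.toIsBigraphon hF), ⟨(key₁ F hF).1, (key₂ F hF).1⟩,
    ⟨(key₁ F hF).2.trans_lt ?_, (key₂ F hF).2.trans_lt ?_⟩,
    fun F hF => ⟨(key₁ F hF).2, (key₂ F hF).2⟩⟩ <;>
  exact EReal.coe_lt_top ((10 * F.numNodes : ℕ) : ℝ)
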